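/- Let $d\ge 1$ and let $T^d=\{x\in\mathbb{R}^d: x_1\ge 0,\dots,x_d\ge 0,\ 1-x_1-\cdots-x_d\ge 0\}$ be the simplex; for $x\in\mathbb{R}^d$ put $x_{d+1}:=1-x_1-\cdots-x_d$. Let $\kappa=(\kappa_1,\dots,\kappa_{d+1})$ with all $\kappa_i\ge 0$, let $|\kappa|=\kappa_1+\cdots+\kappa_{d+1}$, $\lambda=|\kappa|+\frac{d+1}{2}$, let $W_\kappa(x)=\prod_{i=1}^{d+1}x_i^{\kappa_i-1/2}$ be the Jacobi weight on $T^d$, and consider the inner product $$\langle f,g\rangle=w_\kappa\int_{T^d}f(x)g(x)W_\kappa(x)\,dx,\qquad w_\kappa=\frac{\Gamma(\lambda)}{\prod_{i=1}^{d+1}\Gamma(\kappa_i+\frac12)}.$$ For an integer $n\ge 0$ let $\Pi_n^d$ be the space of real polynomials in $d$ variables of total degree at most $n$. There is a unique reproducing kernel $K_n(W_\kappa;\cdot,\cdot)$ of $\Pi_n^d$ for this inner product, i.e. a unique function on $\mathbb{R}^d\times\mathbb{R}^d$ such that, for every $x\in\mathbb{R}^d$, $K_n(W_\kappa;x,\cdot)\in\Pi_n^d$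 and $\langle K_n(W_\kappa;x,\cdot),p\rangle=p(x)$ for all $p\in\Pi_n^d$. Let $e_1,\dots,e_d$ be the standard basis of $\mathbb{R}^d$ and $e_{d+1}=0$, the vertices of $T^d$. Write $(a)_n=a(a+1)\cdots(a+n-1)$ and let $P_n^{(a,b)}$ be the classical Jacobi polynomial, normalized by $P_n^{(a,b)}(1)=\binom{n+a}{n}=\frac{(a+1)_n}{n!}$. Then, for all $x\in\mathbb{R}^d$ and $1\le i\le d+1$, $$K_n(W_\kappa;x,e_i)=\frac{(\lambda)_n}{(\kappa_i+1/2)_n}\,P_n^{(\lambda-\kappa_i-1/2,\ \kappa_i-1/2)}(2x_i-1).$$ In particular, $$K_n(W_\kappa;e_i,e_i)=\frac{(\lambda)_n}{n!}\,\frac{(\lambda-\kappa_i+1/2)_n}{(\kappa_i+1/2)_n},\qquad 1\le i\le d+1,$$ $$K_n(W_\kappa;e_i,e_j)=(-1)^n\,\frac{(\lambda)_n}{n!},\qquad 1\le i,j\le d+1,\ i\ne j.$$ -/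

import Mathlib

noncomputable section

namespace SimplexJacobi

/-- The shifted factorial `(a)_n = a (a + 1) ⋯ (a + n - 1)`. -/
def poch (a : ℝ) (n : ℕ) : ℝ := (ascPochhammer ℝ n).eval a

/-- The classical Jacobi polynomial `P_n^{(a,b)}(t)`, normalized by
`P_n^{(a,b)}(1) = (a + 1)_n / n!`, in its expansion in powers of `(t - 1) / 2`
(`(a + 1)_n / n!` times the hypergeometric polynomial `₂F₁(-n, n + a + b + 1; a + 1; (1 - t) / 2)`,
with the denominators cancelled). -/
def jacobiP (n : ℕ) (a b t : ℝ) : ℝ :=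
  ∑ k ∈ Finset.range (n + 1),
    poch (n + a + b + 1) k * poch (a + k + 1) (n - k) / (k.factorial * (n - k).factorial) *
      ((t - 1) / 2) ^ k

variable {d : ℕ}

/-- The coordinates `(x_1, …, x_d, x_{d+1})` of `x ∈ ℝ^d`, where `x_{d+1} = 1 - x_1 - ⋯ - x_d`. -/
def coord (x : Fin d → ℝ) : Fin (d + 1) → ℝ :=
  Fin.snoc (α := fun _ => ℝ) x (1 - ∑ j, x j)

/-- The simplex `T^d = {x ∈ ℝ^d : x_1 ≥ 0, …, x_d ≥ 0, 1 - x_1 - ⋯ - x_d ≥ 0}`. -/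
def simplex (d : ℕ) : Set (Fin d → ℝ) :=
  {x | (∀ j, 0 ≤ x j) ∧ 0 ≤ 1 - ∑ j, x j}

/-- The vertices of the simplex: `e_1, …, e_d` is the standard basis of `ℝ^d`, and `e_{d+1} = 0`. -/
def vertex (i : Fin (d + 1)) : Fin d → ℝ :=
  Fin.snoc (α := fun _ => Fin d → ℝ) (fun j => Pi.single j 1) 0 i

/-- The Jacobi weight `W_κ(x) = ∏_{i=1}^{d+1} x_i^{κ_i - 1/2}`. -/
def weight (κ : Fin (d + 1) → ℝ) (x : Fin d → ℝ) : ℝ :=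
  ∏ i, coord x i ^ (κ i - 1 / 2)

/-- The number `λ = |κ| + (d + 1) / 2`, where `|κ| = κ_1 + ⋯ + κ_{d+1}`. -/
def lam (κ : Fin (d + 1) → ℝ) : ℝ := (∑ i, κ i) + ((d : ℝ) + 1) / 2

/-- The normalization constant `w_κ = Γ(|κ| + (d + 1) / 2) / ∏_i Γ(κ_i + 1 / 2)`. -/
def normConst (κ : Fin (d + 1) → ℝ) : ℝ :=
  Real.Gamma (lam κ) / ∏ i, Real.Gamma (κ i + 1 / 2)

/-- The inner product `⟨f, g⟩ = w_κ ∫_{T^d} f(x) g(x) W_κ(x) dx`. -/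
def ip (κ : Fin (d + 1) → ℝ) (f g : (Fin d → ℝ) → ℝ) : ℝ :=
  normConst κ * ∫ x in simplex d, f x * g x * weight κ x

/-- `K` is the reproducing kernel, with respect to the inner product `B`, of the space `Π_n^d` of
real polynomials in `d` variables of total degree at most `n`: for every `x`, the function
`K(x, ·)` lies in `Π_n^d`, and `⟨K(x, ·), p⟩ = p(x)` for all `p ∈ Π_n^d`. -/
def IsReproducingKernel (B : ((Fin d → ℝ) → ℝ) → ((Fin d → ℝ) → ℝ) → ℝ) (n : ℕ)
    (K : (Fin d → ℝ) → (Fin d → ℝ) → ℝ) : Prop :=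
  ∀ x : Fin d → ℝ,
    (∃ q : MvPolynomial (Fin d) ℝ, q.totalDegree ≤ n ∧ ∀ y, K x y = MvPolynomial.eval y q) ∧
    ∀ p : MvPolynomial (Fin d) ℝ, p.totalDegree ≤ n →
      B (K x) (fun y => MvPolynomial.eval y p) = MvPolynomial.eval x p

end SimplexJacobi

end

/-!
Write `a_i = κ_i + 1/2`, so that `λ = ∑ a_i`. The measure `w_κ W_κ(x) dx` is the Dirichlet
distribution with parameters `a_1, …, a_{d+1}`, whose moments in all `d + 1` barycentric
coordinates are explicit (`expect_coordMonomial`):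
`E[∏ x_j ^ m_j] = ∏ (a_j)_{m_j} / (λ)_{|m|}`. They follow from Dirichlet's integral
(`lintegral_dirichletDensity`), an iterated beta integral.

The inner product is positive definite on polynomials, since a polynomial vanishing almost
everywhere on an open subset of the simplex is zero (`eq_zero_of_expect_mul_self`); on the
finite-dimensional space `Π_n^d` this gives the unique reproducing kernel.

Since the inner product is symmetric, `K(x, e_i) = q_i(x)` as soon as `q_i ∈ Π_n^d` satisfies
`⟨q_i, p⟩ = p(e_i)` on `Π_n^d` (`IsReproducingKernel.apply_vertex`). That the claimed Jacobi
polynomial has this property is checked directly. As the coordinates add up to `1`, the space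
`Π_n^d` is spanned by the products `x^m = ∏ x_j ^ m_j` over all `d + 1` coordinates with `|m| = n`
exactly (`coordMonomial_induction`), and such a product takes the value `1` at `e_i` if `m_i = n`
and `0` otherwise. Expanding the Jacobi polynomial in powers of `x_i` (`jacobiP_eq_sum_add_one`), the moment
formula turns `⟨q_i, x^m⟩` into a multiple of `₂F₁(-n, a_i + m_i; a_i; 1) = (-m_i)_n / (a_i)_n`,
because the factors `(λ + n)_k` cancel. This vanishes for `m_i < n` and has the right value for
`m_i = n`. Chu–Vandermonde (`sum_choose_mul_poch_mul_poch`) gives both this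
evaluation and the change of expansion point.
-/

noncomputable section

open MeasureTheory

namespace SimplexJacobi

/-! ### Dirichlet's integral -/

lemma setLIntegral_Ioo_rpow_mul_rpow {a b r : ℝ} (ha : 0 < a) (hb : 0 < b) (hr : 0 < r) :
    ∫⁻ t in Set.Ioo 0 r, ENNReal.ofReal (t ^ (a - 1) * (r - t) ^ (b - 1)) =
      ENNReal.ofReal (r ^ (a + b - 1) * (Real.Gamma a * Real.Gamma b / Real.Gamma (a + b))) := by
  have hβ : 0 < ProbabilityTheory.beta a b := ProbabilityTheory.beta_pos ha hb
  have himg : Set.Ioo 0 r = (fun s => r * s) '' Set.Ioo (0 : ℝ) 1 := by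
    rw [Set.image_mul_left_Ioo hr]; simp
  rw [himg, lintegral_image_eq_lintegral_abs_deriv_mul measurableSet_Ioo
    (f' := fun _ => r) (fun x _ => by
      simpa using ((hasDerivAt_id x).const_mul r).hasDerivWithinAt)
    (fun x _ y _ h => mul_left_cancel₀ hr.ne' h)]
  have h1 := ProbabilityTheory.lintegral_betaPDF_eq_one ha hb
  rw [ProbabilityTheory.lintegral_betaPDF] at h1
  rw [← mul_one (ENNReal.ofReal (r ^ (a + b - 1) * _)), ← h1,
    ← lintegral_const_mul _ (by fun_prop)]
  refine setLIntegral_congr_fun measurableSet_Ioo fun s hs => ?_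
  have hs1 : 0 < 1 - s := sub_pos.2 hs.2
  rw [← ENNReal.ofReal_mul (abs_nonneg _), ← ENNReal.ofReal_mul (by
    change 0 ≤ _ * ProbabilityTheory.beta a b
    positivity)]
  congr 1
  change _ = r ^ (a + b - 1) * ProbabilityTheory.beta a b * _
  rw [abs_of_pos hr, show r - r * s = r * (1 - s) by ring, Real.mul_rpow hr.le hs.1.le,
    Real.mul_rpow hr.le hs1.le, show a + b - 1 = 1 + (a - 1) + (b - 1) by ring,
    Real.rpow_add hr, Real.rpow_add hr, Real.rpow_one]
  field_simp

/-- The unnormalized Dirichlet density with parameters `a` and `c` on the simplex of size `r`,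
extended by zero. -/
def dirichletDensity {d : ℕ} (a : Fin d → ℝ) (c r : ℝ) : (Fin d → ℝ) → ENNReal :=
  Set.indicator {x | (∀ j, 0 ≤ x j) ∧ ∑ j, x j ≤ r}
    fun x => ENNReal.ofReal ((∏ j, x j ^ (a j - 1)) * (r - ∑ j, x j) ^ (c - 1))

lemma measurableSet_simplex_le (d : ℕ) (r : ℝ) :
    MeasurableSet {x : Fin d → ℝ | (∀ j, 0 ≤ x j) ∧ ∑ j, x j ≤ r} := by
  have : {x : Fin d → ℝ | (∀ j, 0 ≤ x j) ∧ ∑ j, x j ≤ r} =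
      (⋂ j, {x | 0 ≤ x j}) ∩ {x | ∑ j, x j ≤ r} := by
    ext; simp
  rw [this]
  exact (MeasurableSet.iInter fun j => measurableSet_le (by fun_prop) (by fun_prop)).inter
    (measurableSet_le (by fun_prop) (by fun_prop))

lemma measurable_dirichletDensity {d : ℕ} (a : Fin d → ℝ) (c r : ℝ) :
    Measurable (dirichletDensity a c r) :=
  Measurable.indicator (by fun_prop) (measurableSet_simplex_le d r)

lemma dirichletDensity_cons {d : ℕ} (a : Fin (d + 1) → ℝ) (c r t : ℝ) (y : Fin d → ℝ) :
    dirichletDensity a c r (Fin.cons t y) =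
      Set.indicator (Set.Ici 0) (fun t => ENNReal.ofReal (t ^ (a 0 - 1))) t *
        dirichletDensity (fun j => a j.succ) c (r - t) y := by
  unfold dirichletDensity
  by_cases ht : 0 ≤ t
  · by_cases hy : (∀ j, 0 ≤ y j) ∧ ∑ j, y j ≤ r - t
    · rw [Set.indicator_of_mem, Set.indicator_of_mem, Set.indicator_of_mem,
        ← ENNReal.ofReal_mul (by positivity)]
      · simp [Fin.prod_univ_succ, Fin.sum_univ_succ, mul_assoc, sub_sub]
      · exact hy
      · exact ht
      · refine ⟨Fin.cases ht hy.1, ?_⟩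
        simp [Fin.sum_univ_succ]; linarith [hy.2]
    · rw [Set.indicator_of_notMem, Set.indicator_of_notMem (s := {x | _}), mul_zero]
      · exact hy
      · rintro ⟨h1, h2⟩
        refine hy ⟨fun j => by simpa using h1 j.succ, ?_⟩
        simp [Fin.sum_univ_succ] at h2; linarith
  · rw [Set.indicator_of_notMem, Set.indicator_of_notMem, zero_mul]
    · simpa using ht
    · rintro ⟨h1, _⟩
      exact ht (by simpa using h1 0)

/-- Dirichlet's integral over the simplex of size `r`; carrying `r` along makes the induction on
the dimension reduce to a one-variable beta integral. -/
theorem lintegral_dirichletDensity {d : ℕ} {a : Fin d → ℝ} {c r : ℝ} (ha : ∀ j, 0 < a j)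
    (hc : 0 < c) (hr : 0 < r) :
    ∫⁻ x, dirichletDensity a c r x =
      ENNReal.ofReal (r ^ ((∑ j, a j) + c - 1) *
        ((∏ j, Real.Gamma (a j)) * Real.Gamma c / Real.Gamma ((∑ j, a j) + c))) := by
  induction d generalizing r with
  | zero =>
    rw [lintegral_unique]
    have : (volume : Measure (Fin 0 → ℝ)) Set.univ = 1 := by
      rw [volume_pi, Measure.pi_of_empty]; simp
    rw [this, mul_one, dirichletDensity, Set.indicator_of_mem (by simp [hr.le])]
    simp [(Real.Gamma_pos_of_pos hc).ne']
  | succ d ih =>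
    have hA : 0 < (∑ j : Fin d, a j.succ) + c :=
      add_pos_of_nonneg_of_pos (Finset.sum_nonneg fun j _ => (ha _).le) hc
    set A := (∑ j : Fin d, a j.succ) + c with hAdef
    set C := (∏ j : Fin d, Real.Gamma (a j.succ)) * Real.Gamma c / Real.Gamma A with hC
    have hC0 : 0 ≤ C := by
      have := Real.Gamma_pos_of_pos hA
      have := Real.Gamma_pos_of_pos hc
      have := Finset.prod_nonneg fun (j : Fin d) (_ : j ∈ Finset.univ) =>
        (Real.Gamma_pos_of_pos (ha j.succ)).le
      positivity
    have hmp := (volume_preserving_piFinSuccAbove (fun _ : Fin (d + 1) => ℝ) 0).symm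
    rw [← hmp.lintegral_comp (measurable_dirichletDensity a c r)]
    have hm : Measurable fun z : ℝ × (Fin d → ℝ) =>
        dirichletDensity a c r ((MeasurableEquiv.piFinSuccAbove (fun _ => ℝ) 0).symm z) :=
      (measurable_dirichletDensity a c r).comp (MeasurableEquiv.measurable _)
    rw [Measure.volume_eq_prod, lintegral_prod _ hm.aemeasurable]
    have hinner : ∀ t : ℝ, t ≠ 0 → t ≠ r → ∫⁻ y : Fin d → ℝ, dirichletDensity a c r
          ((MeasurableEquiv.piFinSuccAbove (fun _ => ℝ) 0).symm (t, y)) =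
        Set.indicator (Set.Ioo 0 r)
          (fun t => ENNReal.ofReal C *
            ENNReal.ofReal (t ^ (a 0 - 1) * (r - t) ^ (A - 1))) t := by
      intro t ht0 htr
      have hcons : ∀ y : Fin d → ℝ,
          (MeasurableEquiv.piFinSuccAbove (fun _ => ℝ) 0).symm (t, y) =
            (Fin.cons t y : Fin (d + 1) → ℝ) := fun y => by
        simp [MeasurableEquiv.piFinSuccAbove]; rfl
      simp_rw [hcons, dirichletDensity_cons]
      rw [lintegral_const_mul _ (measurable_dirichletDensity _ _ _)]
      rcases lt_or_gt_of_ne ht0 with h | h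
      · rw [Set.indicator_of_notMem, Set.indicator_of_notMem, zero_mul]
        · exact fun h' => absurd h'.1 h.not_gt
        · exact fun h' => absurd h' h.not_ge
      rw [Set.indicator_of_mem (show t ∈ Set.Ici 0 from h.le)]
      rcases lt_or_gt_of_ne htr with h2 | h2
      · rw [Set.indicator_of_mem (show t ∈ Set.Ioo 0 r from ⟨h, h2⟩),
          ih (fun j => ha _) (sub_pos.2 h2), ← ENNReal.ofReal_mul (by positivity),
          ← ENNReal.ofReal_mul hC0]
        congr 1
        ring
      · rw [Set.indicator_of_notMem (fun h' : t ∈ Set.Ioo 0 r => absurd h'.2 h2.not_gt)]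
        have : dirichletDensity (fun j => a j.succ) c (r - t) = 0 := by
          funext y
          refine Set.indicator_of_notMem ?_ _
          rintro ⟨h3, h4⟩
          linarith [Finset.sum_nonneg fun j (_ : j ∈ Finset.univ) => h3 j]
        simp [this]
    have hae : ∀ᵐ t : ℝ, t ≠ 0 ∧ t ≠ r := (Measure.ae_ne volume 0).and (Measure.ae_ne volume r)
    rw [lintegral_congr_ae (hae.mono fun t ht => hinner t ht.1 ht.2),
      lintegral_indicator measurableSet_Ioo, lintegral_const_mul _ (by fun_prop),
      setLIntegral_Ioo_rpow_mul_rpow (ha 0) hA hr, ← ENNReal.ofReal_mul hC0]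
    have hsum : (∑ j, a j) + c = a 0 + A := by rw [Fin.sum_univ_succ, hAdef]; ring
    have := (Real.Gamma_pos_of_pos hA).ne'
    rw [hsum, Fin.prod_univ_succ, hC]
    congr 1
    field_simp

/-! ### Shifted factorials and Jacobi polynomials -/

lemma poch_zero (a : ℝ) : poch a 0 = 1 := by simp [poch]

lemma poch_succ_right (a : ℝ) (n : ℕ) : poch a (n + 1) = poch a n * (a + n) :=
  ascPochhammer_succ_eval n a

lemma poch_succ_left (a : ℝ) (n : ℕ) : poch a (n + 1) = a * poch (a + 1) n := by
  simp [poch, ascPochhammer_succ_left]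

lemma poch_pos {a : ℝ} (ha : 0 < a) (n : ℕ) : 0 < poch a n := ascPochhammer_pos n a ha

lemma poch_add (a : ℝ) (m n : ℕ) : poch a (m + n) = poch a m * poch (a + m) n := by
  induction n with
  | zero => simp [poch_zero]
  | succ n ih => rw [← add_assoc, poch_succ_right, ih, poch_succ_right]; push_cast; ring

lemma poch_one (n : ℕ) : poch 1 n = n.factorial := by
  simp [poch, ascPochhammer_eval_one]

/-- Reversing the order of the factors. -/
lemma poch_neg (a : ℝ) (n : ℕ) : poch (-a - n) n = (-1) ^ n * poch (a + 1) n := by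
  induction n with
  | zero => simp [poch_zero]
  | succ n ih =>
    rw [poch_succ_left, poch_succ_right]
    have : -a - (n + 1 : ℕ) + 1 = -a - n := by push_cast; ring
    rw [this, ih]; push_cast; ring

lemma poch_neg_natCast_of_lt {m n : ℕ} (h : m < n) : poch (-(m : ℝ)) n = 0 :=
  ascPochhammer_eval_neg_coe_nat_of_lt h

lemma poch_neg_natCast_self (n : ℕ) : poch (-(n : ℝ)) n = (-1) ^ n * n.factorial := by
  simpa [poch_one] using poch_neg 0 n

lemma Gamma_add_natCast {a : ℝ} (ha : 0 < a) (n : ℕ) :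
    Real.Gamma (a + n) = poch a n * Real.Gamma a := by
  induction n with
  | zero => simp [poch_zero]
  | succ n ih =>
    have : a + n ≠ 0 := by positivity
    rw [Nat.cast_succ, ← add_assoc, Real.Gamma_add_one this, ih, poch_succ_right]; ring

/-- The Chu–Vandermonde identity `₂F₁(-N, b; c; 1) = (c - b)_N / (c)_N` with the denominators
cleared. -/
theorem sum_choose_mul_poch_mul_poch (N : ℕ) (b c : ℝ) :
    ∑ l ∈ Finset.range (N + 1), (-1) ^ l * (N.choose l : ℝ) * poch b l * poch (c + l) (N - l) =
      poch (c - b) N := by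
  induction N generalizing b c with
  | zero => simp [poch_zero]
  | succ N ih =>
    -- Pascal's rule splits the sum into two sums of length `N`
    have h1 : ∑ l ∈ Finset.range (N + 2),
        (-1) ^ l * (N.choose l : ℝ) * poch b l * poch (c + l) (N + 1 - l) =
        (c + N) * poch (c - b) N := by
      rw [Finset.sum_range_succ, Nat.choose_succ_self, ← ih b c, Finset.mul_sum]
      simp only [Nat.cast_zero, mul_zero, zero_mul, add_zero]
      refine Finset.sum_congr rfl fun l hl => ?_
      have hl' : l ≤ N := Nat.lt_succ_iff.1 (Finset.mem_range.1 hl)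
      rw [Nat.succ_sub hl', poch_succ_right, Nat.cast_sub hl']; ring
    have h2 : ∑ l ∈ Finset.range (N + 1),
        (-1) ^ (l + 1) * (N.choose l : ℝ) * poch b (l + 1) * poch (c + (l + 1 : ℕ)) (N - l) =
        -b * poch (c - b) N := by
      have := ih (b + 1) (c + 1)
      rw [show c + 1 - (b + 1) = c - b by ring] at this
      rw [← this, Finset.mul_sum]
      refine Finset.sum_congr rfl fun l _ => ?_
      rw [poch_succ_left, show c + (l + 1 : ℕ) = c + 1 + l by push_cast; ring]; ring
    have h3 : ∑ l ∈ Finset.range (N + 2),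
        (-1) ^ l * ((N + 1).choose l : ℝ) * poch b l * poch (c + l) (N + 1 - l) =
        (c + N) * poch (c - b) N + -b * poch (c - b) N := by
      rw [← h1, ← h2, Finset.sum_range_succ' _ (N + 1), Finset.sum_range_succ' _ (N + 1),
        add_right_comm, ← Finset.sum_add_distrib]
      congr 1
      · refine Finset.sum_congr rfl fun l _ => ?_
        rw [Nat.choose_succ_succ, Nat.add_sub_add_right]; push_cast; ring
      · simp
    rw [h3, poch_succ_right]; ring

/-- The expansion of the Jacobi polynomial at the other endpoint `t = -1` of its interval. -/
theorem jacobiP_eq_sum_add_one (n : ℕ) (a b t : ℝ) :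
    jacobiP n a b t = ∑ k ∈ Finset.range (n + 1),
      (-1) ^ (n - k) * poch (n + a + b + 1) k * poch (b + k + 1) (n - k) /
        (k.factorial * (n - k).factorial) * ((t + 1) / 2) ^ k := by
  set u := (t + 1) / 2 with hu
  have ht : (t - 1) / 2 = u + -1 := by rw [hu]; ring
  unfold jacobiP
  rw [ht]
  simp_rw [add_pow u (-1), Finset.mul_sum]
  simp_rw [Finset.range_eq_Ico]
  rw [← Finset.sum_Ico_Ico_comm]
  refine Finset.sum_congr rfl fun j hj => ?_
  have hjn : j ≤ n := Nat.lt_succ_iff.1 (Finset.mem_Ico.1 hj).2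
  obtain ⟨N, rfl⟩ := Nat.exists_eq_add_of_le hjn
  rw [Finset.sum_Ico_eq_sum_range, show j + N + 1 - j = N + 1 by omega]
  -- the coefficient of `u ^ j` is a Chu–Vandermonde sum
  have key := sum_choose_mul_poch_mul_poch N ((j + N : ℕ) + a + b + 1 + j) (a + j + 1)
  rw [show a + j + 1 - ((j + N : ℕ) + a + b + 1 + j) = -(b + j) - N by push_cast; ring,
    poch_neg] at key
  have hR : (-1 : ℝ) ^ (j + N - j) * poch ((j + N : ℕ) + a + b + 1) j *
      poch (b + j + 1) (j + N - j) / (j.factorial * (j + N - j).factorial) * u ^ j =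
      poch ((j + N : ℕ) + a + b + 1) j / (j.factorial * N.factorial) * u ^ j *
        ((-1) ^ N * poch (b + j + 1) N) := by
    rw [Nat.add_sub_cancel_left]; ring
  rw [hR, ← key, Finset.mul_sum]
  refine Finset.sum_congr rfl fun l hl => ?_
  have hl' : l ≤ N := Nat.lt_succ_iff.1 (Finset.mem_range.1 hl)
  obtain ⟨M, rfl⟩ := Nat.exists_eq_add_of_le hl'
  rw [show j + (l + M) - (j + l) = M by omega, Nat.add_sub_cancel_left, Nat.add_sub_cancel_left,
    poch_add _ j l, Nat.cast_add_choose, Nat.cast_add_choose,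
    show a + (j + l : ℕ) + 1 = a + j + 1 + l by push_cast; ring]
  have hf : ∀ m : ℕ, (m.factorial : ℝ) ≠ 0 := fun m => by positivity
  have h1 := hf j
  have h2 := hf l
  have h3 := hf M
  have h4 := hf (j + l)
  have h5 := hf (l + M)
  field_simp

lemma jacobiP_one (n : ℕ) (a b : ℝ) : jacobiP n a b 1 = poch (a + 1) n / n.factorial := by
  unfold jacobiP
  rw [Finset.sum_eq_single 0]
  · simp [poch_zero]
  · intro k _ hk; simp [hk]
  · simp

lemma jacobiP_neg_one (n : ℕ) (a b : ℝ) :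
    jacobiP n a b (-1) = (-1) ^ n * poch (b + 1) n / n.factorial := by
  rw [jacobiP_eq_sum_add_one, Finset.sum_eq_single 0]
  · simp [poch_zero]
  · intro k _ hk; simp [hk]
  · simp

/-! ### The Jacobi weight -/

variable {d : ℕ}

lemma coord_nonneg {x : Fin d → ℝ} (hx : x ∈ simplex d) (i : Fin (d + 1)) : 0 ≤ coord x i := by
  refine Fin.lastCases ?_ (fun j => ?_) i
  · simpa [coord] using hx.2
  · simpa [coord] using hx.1 j

lemma coord_vertex (i j : Fin (d + 1)) : coord (vertex i) j = if j = i then 1 else 0 := by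
  refine Fin.lastCases ?_ (fun i => ?_) i <;> refine Fin.lastCases ?_ (fun j => ?_) j
  · simp [coord, vertex]
  · simp [coord, vertex, (Fin.castSucc_lt_last j).ne]
  · simp [coord, vertex, (Fin.castSucc_lt_last i).ne']
  · simp [coord, vertex, Pi.single_apply]

lemma lam_eq_sum (κ : Fin (d + 1) → ℝ) : lam κ = ∑ i, (κ i + 1 / 2) := by
  rw [lam, Finset.sum_add_distrib]; simp; ring

lemma lam_pos {κ : Fin (d + 1) → ℝ} (h : ∀ i, 0 < κ i + 1 / 2) : 0 < lam κ := by
  rw [lam_eq_sum]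
  exact Finset.sum_pos (fun i _ => h i) Finset.univ_nonempty

lemma lam_add_natCast (κ : Fin (d + 1) → ℝ) (m : Fin (d + 1) → ℕ) :
    lam (fun i => κ i + m i) = lam κ + (∑ i, m i : ℕ) := by
  simp only [lam, Finset.sum_add_distrib]; push_cast; ring

lemma simplex_eq (d : ℕ) :
    simplex d = {x : Fin d → ℝ | (∀ j, 0 ≤ x j) ∧ ∑ j, x j ≤ 1} := by
  ext x; simp [simplex]

lemma measurableSet_simplex (d : ℕ) : MeasurableSet (simplex d) := by
  rw [simplex_eq]; exact measurableSet_simplex_le d 1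

lemma weight_eq (κ : Fin (d + 1) → ℝ) (x : Fin d → ℝ) :
    weight κ x = (∏ j : Fin d, x j ^ (κ j.castSucc - 1 / 2)) *
      (1 - ∑ j, x j) ^ (κ (Fin.last d) - 1 / 2) := by
  simp [weight, coord, Fin.prod_univ_castSucc]

lemma weight_nonneg (κ : Fin (d + 1) → ℝ) {x : Fin d → ℝ} (hx : x ∈ simplex d) :
    0 ≤ weight κ x :=
  Finset.prod_nonneg fun i _ => Real.rpow_nonneg (coord_nonneg hx i) _

lemma measurable_weight (κ : Fin (d + 1) → ℝ) : Measurable (weight κ) := by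
  rw [funext (weight_eq κ)]; fun_prop

lemma prod_coord_pow_mul_weight {κ : Fin (d + 1) → ℝ} (h : ∀ i, 0 < κ i + 1 / 2)
    (m : Fin (d + 1) → ℕ) {x : Fin d → ℝ} (hx : x ∈ simplex d) :
    (∏ i, coord x i ^ m i) * weight κ x = weight (fun i => κ i + m i) x := by
  rw [weight, weight, ← Finset.prod_mul_distrib]
  refine Finset.prod_congr rfl fun i _ => ?_
  rcases Nat.eq_zero_or_pos (m i) with hm | hm
  · simp [hm]
  · have hm' : (1 : ℝ) ≤ m i := by exact_mod_cast hm
    -- the exponent on the right is nonzero, so the identity also holds where `coord x i = 0`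
    have := h i
    rw [show κ i + m i - 1 / 2 = κ i - 1 / 2 + m i by ring,
      Real.rpow_add_natCast' (coord_nonneg hx i) (by linarith : κ i - 1 / 2 + (m i : ℝ) ≠ 0),
      mul_comm]

lemma setLIntegral_weight {κ : Fin (d + 1) → ℝ} (h : ∀ i, 0 < κ i + 1 / 2) :
    ∫⁻ x in simplex d, ENNReal.ofReal (weight κ x) =
      ENNReal.ofReal ((∏ i, Real.Gamma (κ i + 1 / 2)) / Real.Gamma (lam κ)) := by
  have := lintegral_dirichletDensity (a := fun j : Fin d => κ j.castSucc + 1 / 2)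
    (fun j => h _) (h (Fin.last d)) one_pos
  rw [← lintegral_indicator (measurableSet_simplex d), lam_eq_sum, Fin.prod_univ_castSucc,
    Fin.sum_univ_castSucc]
  rw [Real.one_rpow, one_mul] at this
  rw [← this, simplex_eq]
  refine lintegral_congr fun x => ?_
  have hexp : ∀ t : ℝ, t + 1 / 2 - 1 = t - 1 / 2 := fun t => by ring
  simp only [dirichletDensity, hexp, ← weight_eq]

lemma integrableOn_weight {κ : Fin (d + 1) → ℝ} (h : ∀ i, 0 < κ i + 1 / 2) :
    IntegrableOn (weight κ) (simplex d) := by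
  refine ⟨(measurable_weight κ).aestronglyMeasurable, ?_⟩
  rw [hasFiniteIntegral_iff_ofReal, setLIntegral_weight h]
  · exact ENNReal.ofReal_lt_top
  · exact (ae_restrict_iff' (measurableSet_simplex d)).2 (.of_forall fun x => weight_nonneg κ)

/-- Dirichlet's integral of the Jacobi weight. -/
lemma setIntegral_weight {κ : Fin (d + 1) → ℝ} (h : ∀ i, 0 < κ i + 1 / 2) :
    ∫ x in simplex d, weight κ x = (∏ i, Real.Gamma (κ i + 1 / 2)) / Real.Gamma (lam κ) := by
  rw [integral_eq_lintegral_of_nonneg_ae, setLIntegral_weight h, ENNReal.toReal_ofReal]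
  · exact div_nonneg (Finset.prod_nonneg fun i _ => (Real.Gamma_pos_of_pos (h i)).le)
      (Real.Gamma_pos_of_pos (lam_pos h)).le
  · exact (ae_restrict_iff' (measurableSet_simplex d)).2 (.of_forall fun x => weight_nonneg κ)
  · exact (measurable_weight κ).aestronglyMeasurable

lemma normConst_pos {κ : Fin (d + 1) → ℝ} (h : ∀ i, 0 < κ i + 1 / 2) : 0 < normConst κ :=
  div_pos (Real.Gamma_pos_of_pos (lam_pos h))
    (Finset.prod_pos fun i _ => Real.Gamma_pos_of_pos (h i))

/-! ### Polynomials in the barycentric coordinates -/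

/-- The coordinate `x_i`, `1 ≤ i ≤ d + 1`, as a polynomial in `x_1, …, x_d`. -/
def coordPoly : Fin (d + 1) → MvPolynomial (Fin d) ℝ :=
  Fin.snoc (α := fun _ => MvPolynomial (Fin d) ℝ) MvPolynomial.X (1 - ∑ j, MvPolynomial.X j)

@[simp]
lemma eval_coordPoly (x : Fin d → ℝ) (i : Fin (d + 1)) :
    MvPolynomial.eval x (coordPoly i) = coord x i := by
  refine Fin.lastCases ?_ (fun j => ?_) i <;> simp [coordPoly, coord]

lemma sum_coordPoly : ∑ i, coordPoly (d := d) i = 1 := by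
  simp [coordPoly, Fin.sum_univ_castSucc]

lemma totalDegree_coordPoly_le (i : Fin (d + 1)) :
    (coordPoly (d := d) i).totalDegree ≤ 1 := by
  refine Fin.lastCases ?_ (fun j => ?_) i
  · simp only [coordPoly, Fin.snoc_last]
    refine (MvPolynomial.totalDegree_sub _ _).trans (max_le (by simp) ?_)
    exact MvPolynomial.totalDegree_finsetSum_le fun j _ => by simp
  · simp [coordPoly]

/-- The product `∏ i, x_i ^ m_i` over all `d + 1` coordinates, as a polynomial. -/
def coordMonomial (m : Fin (d + 1) → ℕ) : MvPolynomial (Fin d) ℝ := ∏ i, coordPoly i ^ m i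

lemma coordPoly_pow_mul_coordMonomial (i : Fin (d + 1)) (k : ℕ) (m : Fin (d + 1) → ℕ) :
    coordPoly i ^ k * coordMonomial m = coordMonomial (m + Pi.single i k) := by
  simp only [coordMonomial, Pi.add_apply, pow_add, Finset.prod_mul_distrib]
  rw [mul_comm]
  congr 1
  rw [Finset.prod_eq_single i] <;> simp +contextual

lemma monomial_eq_coordMonomial (s : Fin d →₀ ℕ) :
    MvPolynomial.monomial s (1 : ℝ) =
      coordMonomial (Fin.snoc (α := fun _ => ℕ) s 0) := by
  simp [coordMonomial, coordPoly, Fin.prod_univ_castSucc, MvPolynomial.monomial_eq,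
    Finsupp.prod_fintype]

/-- A property of polynomials of degree at most `n` that is stable under linear combinations
only has to be verified on the products of exactly `n` of the `d + 1` coordinates, because
the coordinates add up to `1`. -/
theorem coordMonomial_induction {n : ℕ} {motive : MvPolynomial (Fin d) ℝ → Prop}
    (h0 : motive 0) (hadd : ∀ p q, motive p → motive q → motive (p + q))
    (hsmul : ∀ (c : ℝ) p, motive p → motive (c • p))
    (hmon : ∀ m : Fin (d + 1) → ℕ, ∑ i, m i = n → motive (coordMonomial m))
    {p : MvPolynomial (Fin d) ℝ} (hp : p.totalDegree ≤ n) : motive p := by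
  have hsum : ∀ {ι : Type} (s : Finset ι) (f : ι → MvPolynomial (Fin d) ℝ),
      (∀ i ∈ s, motive (f i)) → motive (∑ i ∈ s, f i) := fun s f hf =>
    Finset.sum_induction f motive hadd h0 hf
  have hle : ∀ (k : ℕ) (m : Fin (d + 1) → ℕ), ∑ i, m i + k = n → motive (coordMonomial m) := by
    intro k
    induction k with
    | zero => intro m hm; exact hmon m hm
    | succ k ih =>
      intro m hm
      have : coordMonomial m = ∑ i, coordMonomial (m + Pi.single i 1) := by
        rw [← mul_one (coordMonomial m), ← sum_coordPoly, Finset.mul_sum]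
        refine Finset.sum_congr rfl fun i _ => ?_
        rw [← coordPoly_pow_mul_coordMonomial, pow_one, mul_comm]
      rw [this]
      refine hsum _ _ fun i _ => ih _ ?_
      simp [Finset.sum_add_distrib]; omega
  rw [← p.support_sum_monomial_coeff]
  refine Finset.sum_induction _ motive hadd h0 fun s hs => ?_
  have hs' : ∑ j, s j ≤ n := by
    have := (MvPolynomial.le_totalDegree hs).trans hp
    rwa [Finsupp.sum_fintype _ _ (fun _ => rfl)] at this
  rw [← mul_one (p.coeff s), ← smul_eq_mul, ← MvPolynomial.smul_monomial]
  refine hsmul _ _ ?_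
  rw [monomial_eq_coordMonomial]
  refine hle (n - ∑ j, s j) _ ?_
  simp [Fin.sum_univ_castSucc]; omega

/-! ### Moments and positive definiteness -/

lemma integrableOn_eval_mul_weight {κ : Fin (d + 1) → ℝ} (h : ∀ i, 0 < κ i + 1 / 2)
    (p : MvPolynomial (Fin d) ℝ) :
    IntegrableOn (fun x => MvPolynomial.eval x p * weight κ x) (simplex d) := by
  refine coordMonomial_induction (n := p.totalDegree)
    (motive := fun p => IntegrableOn (fun x => MvPolynomial.eval x p * weight κ x) (simplex d))
    ?_ ?_ ?_ ?_ le_rfl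
  · simp
  · intro p q hp hq
    simp only [map_add, add_mul]
    exact hp.add hq
  · intro c p hp
    simp only [MvPolynomial.smul_eval, mul_assoc]
    exact hp.const_mul c
  · intro m _
    refine (integrableOn_weight (κ := fun i => κ i + m i) fun i => ?_).congr_fun (fun x hx => ?_)
      (measurableSet_simplex d)
    · have := h i
      have : (0 : ℝ) ≤ m i := by positivity
      linarith
    · simp [coordMonomial, ← prod_coord_pow_mul_weight h m hx]

/-- The normalized integral `p ↦ w_κ ∫_{T^d} p(x) W_κ(x) dx` of a polynomial. -/
def expect (κ : Fin (d + 1) → ℝ) (p : MvPolynomial (Fin d) ℝ) : ℝ :=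
  normConst κ * ∫ x in simplex d, MvPolynomial.eval x p * weight κ x

lemma ip_eval (κ : Fin (d + 1) → ℝ) (p q : MvPolynomial (Fin d) ℝ) :
    ip κ (fun x => MvPolynomial.eval x p) (fun x => MvPolynomial.eval x q) = expect κ (p * q) := by
  simp [ip, expect]

lemma expect_add {κ : Fin (d + 1) → ℝ} (h : ∀ i, 0 < κ i + 1 / 2)
    (p q : MvPolynomial (Fin d) ℝ) : expect κ (p + q) = expect κ p + expect κ q := by
  simp only [expect, map_add, add_mul, ← mul_add]
  rw [integral_add (integrableOn_eval_mul_weight h p) (integrableOn_eval_mul_weight h q)]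

lemma expect_smul (κ : Fin (d + 1) → ℝ) (c : ℝ) (p : MvPolynomial (Fin d) ℝ) :
    expect κ (c • p) = c * expect κ p := by
  simp only [expect, MvPolynomial.smul_eval, mul_assoc, integral_const_mul]
  ring

/-- The moments of the Dirichlet distribution. -/
theorem expect_coordMonomial {κ : Fin (d + 1) → ℝ} (h : ∀ i, 0 < κ i + 1 / 2)
    (m : Fin (d + 1) → ℕ) :
    expect κ (coordMonomial m) = (∏ i, poch (κ i + 1 / 2) (m i)) / poch (lam κ) (∑ i, m i) := by
  have h' : ∀ i, 0 < (κ i + m i) + 1 / 2 := fun i => by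
    have := h i
    have : (0 : ℝ) ≤ m i := by positivity
    linarith
  have h1 : ∫ x in simplex d, MvPolynomial.eval x (coordMonomial m) * weight κ x =
      ∫ x in simplex d, weight (fun i => κ i + m i) x :=
    setIntegral_congr_fun (measurableSet_simplex d) fun x hx => by
      simp [coordMonomial, ← prod_coord_pow_mul_weight h m hx]
  rw [expect, h1, setIntegral_weight h', lam_add_natCast, Gamma_add_natCast (lam_pos h)]
  have h2 : ∀ i, Real.Gamma (κ i + m i + 1 / 2) =
      poch (κ i + 1 / 2) (m i) * Real.Gamma (κ i + 1 / 2) := fun i => by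
    rw [← Gamma_add_natCast (h i), add_right_comm]
  simp_rw [h2]
  rw [Finset.prod_mul_distrib, normConst]
  have h3 := (Real.Gamma_pos_of_pos (lam_pos h)).ne'
  have h4 : ∏ i, Real.Gamma (κ i + 1 / 2) ≠ 0 :=
    Finset.prod_ne_zero_iff.2 fun i _ => (Real.Gamma_pos_of_pos (h i)).ne'
  generalize ∏ i, Real.Gamma (κ i + 1 / 2) = G at h4 ⊢
  generalize ∏ i, poch (κ i + 1 / 2) (m i) = P
  field_simp

/-- The inner product is positive definite on polynomials. -/
theorem eq_zero_of_expect_mul_self {κ : Fin (d + 1) → ℝ} (h : ∀ i, 0 < κ i + 1 / 2)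
    {p : MvPolynomial (Fin d) ℝ} (hp : expect κ (p * p) = 0) : p = 0 := by
  have h1 := (mul_eq_zero.1 hp).resolve_left (normConst_pos h).ne'
  rw [setIntegral_eq_zero_iff_of_nonneg_ae ?_ (integrableOn_eval_mul_weight h (p * p))] at h1
  swap
  · refine (ae_restrict_iff' (measurableSet_simplex d)).2 (.of_forall fun x hx => ?_)
    simpa using mul_nonneg (mul_self_nonneg _) (weight_nonneg κ hx)
  -- a box in the interior of the simplex
  set U : Set (Fin d → ℝ) := Set.univ.pi fun _ => Set.Ioo (0 : ℝ) (1 / (d + 1)) with hU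
  have hUo : IsOpen U := isOpen_set_pi Set.finite_univ fun _ _ => isOpen_Ioo
  have hUsum : ∀ x ∈ U, ∑ j, x j < 1 := fun x hx => by
    have : ∑ j, x j ≤ ∑ _j : Fin d, (1 / (d + 1) : ℝ) :=
      Finset.sum_le_sum fun j _ => (hx j trivial).2.le
    refine this.trans_lt ?_
    rw [Finset.sum_const, Finset.card_univ, Fintype.card_fin, nsmul_eq_mul, mul_one_div,
      div_lt_one (by positivity)]
    linarith
  have hUs : U ⊆ simplex d := fun x hx =>
    ⟨fun j => (hx j trivial).1.le, (sub_pos.2 (hUsum x hx)).le⟩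
  have hUpos : ∀ x ∈ U, 0 < weight κ x := fun x hx => by
    rw [weight_eq]
    exact mul_pos (Finset.prod_pos fun j _ => Real.rpow_pos_of_pos (hx j trivial).1 _)
      (Real.rpow_pos_of_pos (sub_pos.2 (hUsum x hx)) _)
  have h2 : (fun x => MvPolynomial.eval x p) =ᵐ[volume.restrict U] fun _ => 0 := by
    filter_upwards [ae_restrict_of_ae_restrict_of_subset hUs h1,
      ae_restrict_mem hUo.measurableSet] with x hx hxU
    have := (mul_eq_zero.1 hx).resolve_right (hUpos x hxU).ne'
    simpa using this
  have h3 := Measure.eqOn_open_of_ae_eq h2 hUo (MvPolynomial.continuous_eval p).continuousOn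
    continuousOn_const
  refine MvPolynomial.funext_set (fun _ => Set.Ioo (0 : ℝ) (1 / (d + 1)))
    (fun _ => Set.Ioo_infinite (by positivity)) fun x hx => ?_
  simpa using h3 hx

/-! ### Existence and uniqueness of the reproducing kernel -/

/-- The inner product on `Π_n^d` as a linear map into the dual space. -/
def toDual {κ : Fin (d + 1) → ℝ} (h : ∀ i, 0 < κ i + 1 / 2) (n : ℕ) :
    MvPolynomial.restrictTotalDegree (Fin d) ℝ n →ₗ[ℝ]
      Module.Dual ℝ (MvPolynomial.restrictTotalDegree (Fin d) ℝ n) :=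
  LinearMap.mk₂ ℝ (fun p q => expect κ (p.1 * q.1))
    (fun p p' q => by simp [add_mul, expect_add h])
    (fun c p q => by simp [expect_smul])
    (fun p q q' => by simp [mul_add, expect_add h])
    (fun c p q => by simp [expect_smul])

/-- Existence half of the Riesz representation theorem for point evaluations on `Π_n^d`. -/
lemma exists_reproducing {κ : Fin (d + 1) → ℝ} (h : ∀ i, 0 < κ i + 1 / 2) (n : ℕ)
    (x : Fin d → ℝ) :
    ∃ q : MvPolynomial (Fin d) ℝ, q.totalDegree ≤ n ∧
      ∀ p : MvPolynomial (Fin d) ℝ, p.totalDegree ≤ n →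
        expect κ (q * p) = MvPolynomial.eval x p := by
  have hinj : Function.Injective (toDual h n) :=
    (injective_iff_map_eq_zero _).2 fun p hp =>
      Subtype.ext (eq_zero_of_expect_mul_self h (congrArg (fun f => f p) hp))
  have hsurj := (LinearMap.injective_iff_surjective_of_finrank_eq_finrank
    Subspace.dual_finrank_eq.symm).1 hinj
  obtain ⟨q, hq⟩ := hsurj
    ((MvPolynomial.aeval x).toLinearMap.comp (Submodule.subtype _))
  refine ⟨q, (MvPolynomial.mem_restrictTotalDegree _ _ _).1 q.2, fun p hp => ?_⟩
  have := congrArg (fun f => f ⟨p, (MvPolynomial.mem_restrictTotalDegree _ _ _).2 hp⟩) hq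
  simpa [toDual, MvPolynomial.aeval_eq_eval] using this

lemma reproducing_unique {κ : Fin (d + 1) → ℝ} (h : ∀ i, 0 < κ i + 1 / 2) {n : ℕ}
    {x : Fin d → ℝ} {q q' : MvPolynomial (Fin d) ℝ} (hq : q.totalDegree ≤ n)
    (hq' : q'.totalDegree ≤ n)
    (hr : ∀ p : MvPolynomial (Fin d) ℝ, p.totalDegree ≤ n →
      expect κ (q * p) = MvPolynomial.eval x p)
    (hr' : ∀ p : MvPolynomial (Fin d) ℝ, p.totalDegree ≤ n →
      expect κ (q' * p) = MvPolynomial.eval x p) : q = q' := by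
  have hdeg : (q - q').totalDegree ≤ n := (MvPolynomial.totalDegree_sub _ _).trans (max_le hq hq')
  refine sub_eq_zero.1 (eq_zero_of_expect_mul_self h ?_)
  have : (q - q') * (q - q') = q * (q - q') + (-1 : ℝ) • (q' * (q - q')) := by
    rw [neg_one_smul]; ring
  rw [this, expect_add h, expect_smul, hr _ hdeg, hr' _ hdeg]
  ring

theorem existsUnique_isReproducingKernel {κ : Fin (d + 1) → ℝ} (h : ∀ i, 0 < κ i + 1 / 2)
    (n : ℕ) : ∃! K : (Fin d → ℝ) → (Fin d → ℝ) → ℝ, IsReproducingKernel (ip κ) n K := by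
  choose q hq hr using exists_reproducing h n
  refine ⟨fun x y => MvPolynomial.eval y (q x), fun x => ⟨⟨q x, hq x, fun _ => rfl⟩,
    fun p hp => by rw [ip_eval, hr x p hp]⟩, fun K hK => ?_⟩
  funext x y
  obtain ⟨⟨q', hq', hKq⟩, hrep⟩ := hK x
  rw [hKq y, reproducing_unique h hq' (hq x) (fun p hp => ?_) (hr x)]
  rw [← hrep p hp, funext hKq, ip_eval]

/-! ### The kernel at a vertex -/

/-- The polynomial `(λ)_n / (κ_i + 1/2)_n P_n^{(λ - κ_i - 1/2, κ_i - 1/2)}(2 x_i - 1)`, expanded in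
powers of `x_i`. -/
def vertexKernel (κ : Fin (d + 1) → ℝ) (n : ℕ) (i : Fin (d + 1)) : MvPolynomial (Fin d) ℝ :=
  ∑ k ∈ Finset.range (n + 1),
    (poch (lam κ) n / poch (κ i + 1 / 2) n *
      ((-1) ^ (n - k) * poch (lam κ + n) k * poch (κ i + 1 / 2 + k) (n - k) /
        (k.factorial * (n - k).factorial))) • coordPoly i ^ k

lemma eval_vertexKernel (κ : Fin (d + 1) → ℝ) (n : ℕ) (i : Fin (d + 1)) (x : Fin d → ℝ) :
    MvPolynomial.eval x (vertexKernel κ n i) =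
      poch (lam κ) n / poch (κ i + 1 / 2) n *
        jacobiP n (lam κ - κ i - 1 / 2) (κ i - 1 / 2) (2 * coord x i - 1) := by
  rw [jacobiP_eq_sum_add_one, vertexKernel, map_sum, Finset.mul_sum]
  refine Finset.sum_congr rfl fun k _ => ?_
  rw [MvPolynomial.smul_eval, map_pow, eval_coordPoly, mul_assoc,
    show (2 * coord x i - 1 + 1) / 2 = coord x i by ring,
    show n + (lam κ - κ i - 1 / 2) + (κ i - 1 / 2) + 1 = lam κ + n by ring,
    show κ i - 1 / 2 + k + 1 = κ i + 1 / 2 + k by ring]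

lemma totalDegree_vertexKernel_le (κ : Fin (d + 1) → ℝ) (n : ℕ) (i : Fin (d + 1)) :
    (vertexKernel κ n i).totalDegree ≤ n := by
  refine MvPolynomial.totalDegree_finsetSum_le fun k hk => ?_
  refine (MvPolynomial.totalDegree_smul_le _ _).trans ((MvPolynomial.totalDegree_pow _ _).trans ?_)
  have := totalDegree_coordPoly_le (d := d) i
  have := Finset.mem_range.1 hk
  nlinarith

lemma expect_sum {κ : Fin (d + 1) → ℝ} (h : ∀ i, 0 < κ i + 1 / 2) {ι : Type*} (s : Finset ι)
    (f : ι → MvPolynomial (Fin d) ℝ) : expect κ (∑ i ∈ s, f i) = ∑ i ∈ s, expect κ (f i) := by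
  classical
  induction s using Finset.induction_on with
  | empty => simp [expect]
  | insert i s hi ih => rw [Finset.sum_insert hi, Finset.sum_insert hi, expect_add h, ih]

/-- `vertexKernel κ n i` represents evaluation at the vertex `e_i` on products of `n` coordinates. -/
lemma expect_vertexKernel_mul_coordMonomial {κ : Fin (d + 1) → ℝ} (h : ∀ i, 0 < κ i + 1 / 2)
    {n : ℕ} (i : Fin (d + 1)) {m : Fin (d + 1) → ℕ} (hm : ∑ j, m j = n) :
    expect κ (vertexKernel κ n i * coordMonomial m) =
      MvPolynomial.eval (vertex i) (coordMonomial m) := by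
  have hl := lam_pos h
  set a := κ i + 1 / 2 with ha
  have ha0 : 0 < a := h i
  have hmom : ∀ k, expect κ (coordPoly i ^ k * coordMonomial m) =
      (∏ j, poch (κ j + 1 / 2) (m j)) * poch (a + m i) k /
        (poch (lam κ) n * poch (lam κ + n) k) := fun k => by
    rw [coordPoly_pow_mul_coordMonomial, expect_coordMonomial h]
    congr 1
    · simp only [Pi.add_apply, poch_add, Finset.prod_mul_distrib]
      congr 1
      rw [Finset.prod_eq_single i] <;> simp +contextual [poch_zero, ha]
    · simp [Finset.sum_add_distrib, hm, poch_add]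
  have hcv := sum_choose_mul_poch_mul_poch n (a + m i) a
  rw [show a - (a + m i) = -(m i : ℝ) by ring] at hcv
  -- the factors `(λ + n)_k` of the kernel and of the moments cancel, leaving a `₂F₁` at `1`
  have hsum : expect κ (vertexKernel κ n i * coordMonomial m) =
      (∏ j, poch (κ j + 1 / 2) (m j)) / poch a n * ((-1) ^ n / n.factorial) *
        poch (-(m i : ℝ)) n := by
    rw [vertexKernel, Finset.sum_mul, expect_sum h, ← hcv, Finset.mul_sum]
    refine Finset.sum_congr rfl fun k hk => ?_
    have hk' : k ≤ n := Nat.lt_succ_iff.1 (Finset.mem_range.1 hk)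
    rw [smul_mul_assoc, expect_smul, hmom, ← ha]
    have h1 := (poch_pos hl n).ne'
    have h2 := (poch_pos (by positivity : 0 < lam κ + n) k).ne'
    have h3 := (poch_pos ha0 n).ne'
    have hs : (-1 : ℝ) ^ (n - k) = (-1) ^ n * (-1) ^ k := by
      obtain ⟨l, rfl⟩ := Nat.exists_eq_add_of_le hk'
      rw [Nat.add_sub_cancel_left, pow_add, mul_right_comm, ← mul_pow]; simp
    rw [hs, Nat.cast_choose ℝ hk']
    have hf : ∀ m : ℕ, (m.factorial : ℝ) ≠ 0 := fun m => by positivity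
    have := hf n
    have := hf k
    have := hf (n - k)
    generalize ∏ j, poch (κ j + 1 / 2) (m j) = P
    field_simp
  rw [hsum]
  have heval : MvPolynomial.eval (vertex i) (coordMonomial m) =
      ∏ j, (if j = i then (1 : ℝ) else 0) ^ m j := by
    simp [coordMonomial, coord_vertex]
  rw [heval]
  by_cases hmi : m i = n
  · have hz : ∀ j, j ≠ i → m j = 0 := fun j hj => by
      have h1 := Finset.add_sum_erase Finset.univ m (Finset.mem_univ i)
      have h2 := Finset.single_le_sum (f := m) (fun _ _ => Nat.zero_le _)
        (Finset.mem_erase.2 ⟨hj, Finset.mem_univ j⟩)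
      omega
    rw [Finset.prod_eq_single i, Finset.prod_eq_single i, hmi, poch_neg_natCast_self, ← ha]
    · have h3 := (poch_pos ha0 n).ne'
      have : (n.factorial : ℝ) ≠ 0 := by positivity
      have hs : ((-1 : ℝ) ^ n) ^ 2 = 1 := by rw [← pow_mul, mul_comm, pow_mul]; simp
      simp
      field_simp
      exact hs
    · intro j _ hj; simp [hz j hj]
    · simp
    · intro j _ hj; simp [hz j hj, poch_zero]
    · simp
  · have hlt : m i < n := lt_of_le_of_ne
      (hm ▸ Finset.single_le_sum (f := m) (fun _ _ => Nat.zero_le _) (Finset.mem_univ i)) hmi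
    obtain ⟨j, hj, hmj⟩ : ∃ j, j ≠ i ∧ m j ≠ 0 := by
      by_contra! hc
      exact hmi (by rw [← hm, Finset.sum_eq_single i (fun j _ hj => hc j hj) (by simp)])
    rw [poch_neg_natCast_of_lt hlt, mul_zero, Finset.prod_eq_zero (Finset.mem_univ j)]
    simp [hj, hmj]

/-- `vertexKernel κ n i` represents evaluation at the vertex `e_i` on `Π_n^d`. -/
theorem expect_vertexKernel_mul {κ : Fin (d + 1) → ℝ} (h : ∀ i, 0 < κ i + 1 / 2) {n : ℕ}
    (i : Fin (d + 1)) {p : MvPolynomial (Fin d) ℝ} (hp : p.totalDegree ≤ n) :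
    expect κ (vertexKernel κ n i * p) = MvPolynomial.eval (vertex i) p := by
  refine coordMonomial_induction
    (motive := fun p => expect κ (vertexKernel κ n i * p) = MvPolynomial.eval (vertex i) p)
    ?_ ?_ ?_ (fun m hm => expect_vertexKernel_mul_coordMonomial h i hm) hp
  · simp [expect]
  · intro p q hp hq
    rw [mul_add, expect_add h, hp, hq, map_add]
  · intro c p hp
    rw [mul_smul_comm, expect_smul, hp, MvPolynomial.smul_eval]

/-- By symmetry of the inner product, both sides are `⟨K(x, ·), vertexKernel κ n i⟩`. -/
theorem IsReproducingKernel.apply_vertex {κ : Fin (d + 1) → ℝ} (h : ∀ i, 0 < κ i + 1 / 2) {n : ℕ}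
    {K : (Fin d → ℝ) → (Fin d → ℝ) → ℝ} (hK : IsReproducingKernel (ip κ) n K) (x : Fin d → ℝ)
    (i : Fin (d + 1)) : K x (vertex i) = MvPolynomial.eval x (vertexKernel κ n i) := by
  obtain ⟨⟨q, hq, hKq⟩, hrep⟩ := hK x
  rw [← hrep _ (totalDegree_vertexKernel_le κ n i), funext hKq, ip_eval, mul_comm,
    expect_vertexKernel_mul h i hq]

end SimplexJacobi

end

theorem proposition3p1 (d : ℕ) (hd : 1 ≤ d) (κ : Fin (d + 1) → ℝ) (hκ : ∀ i, 0 ≤ κ i) (n : ℕ) :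
    (∃! K : (Fin d → ℝ) → (Fin d → ℝ) → ℝ,
      SimplexJacobi.IsReproducingKernel (SimplexJacobi.ip κ) n K) ∧
    ∀ K : (Fin d → ℝ) → (Fin d → ℝ) → ℝ,
      SimplexJacobi.IsReproducingKernel (SimplexJacobi.ip κ) n K →
      (∀ (x : Fin d → ℝ) (i : Fin (d + 1)),
        K x (SimplexJacobi.vertex i) =
          SimplexJacobi.poch (SimplexJacobi.lam κ) n / SimplexJacobi.poch (κ i + 1 / 2) n *
            SimplexJacobi.jacobiP n (SimplexJacobi.lam κ - κ i - 1 / 2) (κ i - 1 / 2)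
              (2 * SimplexJacobi.coord x i - 1)) ∧
      (∀ i : Fin (d + 1),
        K (SimplexJacobi.vertex i) (SimplexJacobi.vertex i) =
          SimplexJacobi.poch (SimplexJacobi.lam κ) n / (n.factorial : ℝ) *
            (SimplexJacobi.poch (SimplexJacobi.lam κ - κ i + 1 / 2) n /
              SimplexJacobi.poch (κ i + 1 / 2) n)) ∧
      (∀ i j : Fin (d + 1), i ≠ j →
        K (SimplexJacobi.vertex i) (SimplexJacobi.vertex j) =
          (-1) ^ n * (SimplexJacobi.poch (SimplexJacobi.lam κ) n / (n.factorial : ℝ))) := by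
  have h : ∀ i, 0 < κ i + 1 / 2 := fun i => add_pos_of_nonneg_of_pos (hκ i) one_half_pos
  refine ⟨SimplexJacobi.existsUnique_isReproducingKernel h n, fun K hK => ?_⟩
  have hform := fun (x : Fin d → ℝ) (i : Fin (d + 1)) =>
    (hK.apply_vertex h x i).trans (SimplexJacobi.eval_vertexKernel κ n i x)
  refine ⟨hform, fun i => ?_, fun i j hij => ?_⟩
  · rw [hform, SimplexJacobi.coord_vertex, if_pos rfl,
      show (2 * 1 - 1 : ℝ) = 1 by norm_num, SimplexJacobi.jacobiP_one,
      show SimplexJacobi.lam κ - κ i - 1 / 2 + 1 = SimplexJacobi.lam κ - κ i + 1 / 2 by ring]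
    ring
  · rw [hform, SimplexJacobi.coord_vertex, if_neg hij.symm,
      show (2 * 0 - 1 : ℝ) = -1 by norm_num, SimplexJacobi.jacobiP_neg_one,
      show κ j - 1 / 2 + 1 = κ j + 1 / 2 by ring]
    have := (SimplexJacobi.poch_pos (h j) n).ne'
    generalize SimplexJacobi.poch (κ j + 1 / 2) n = P at this ⊢
    field_simp
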